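/- Let $n\in\mathbb N$. Let $\mathbb S^n$ be the space of real symmetric $n\times n$ matrices, let $\mathbb S^n_+$ and $\mathbb S^n_{++}$ be its subsets of positive semidefinite and of positive definite matrices, and let $$F:\mathbb S^n_{++}\to\mathbb S^n,\qquad F(X)=X^{-1},\qquad \operatorname{gph}F=\{(X,F(X)) : X\in\mathbb S^n_{++}\}\subset\mathbb S^n\times\mathbb S^n .$$ A cone in $\mathbb S^n$ is a nonempty set $K\subset\mathbb S^n$ with $tX\in K$ for all $t\ge 0$ and $X\in K$. For a cone $K$, the $K$-epigraph of $F$ is $$K\text{-}\operatorname{epi}F=\{(X,Y)\in\mathbb S^n_{++}\times\mathbb S^n : Y-F(X)\in K\},$$ and $F$ is called $K$-convex (respectively $K$-closed) if $K\text{-}\operatorname{epi}F$ is convex (respectively closed in $\mathbb S^n\times\mathbb S^n$). Let $K_F$ be the smallest (with respect to inclusion) closed convex cone $K$ such that $F$ is $K$-convex, and let $\hat K_F$ be the smallest closed convex cone $K$ such that $F$ is both $K$-convex and $K$-closed. Then the following hold. a) The cones $K_F$ and $\hat K_F$ exist, and $\hat K_F=K_F=\mathbb S^n_+$. b) $F$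 is $\mathbb S^n_+$-convex and $\mathbb S^n_+$-closed. c) $\overline{\operatorname{conv}}\,(\operatorname{gph}F)=\mathbb S^n_+\text{-}\operatorname{epi}F$, where $\overline{\operatorname{conv}}$ denotes the closed convex hull. -/

import Mathlib

section ConeMaps

variable {E₁ E₂ : Type*}

/-- A cone: a nonempty set that is stable under multiplication by every scalar `t ≥ 0`. -/
def IsCone [AddCommGroup E₂] [Module ℝ E₂] (K : Set E₂) : Prop :=
  K.Nonempty ∧ ∀ t : ℝ, 0 ≤ t → ∀ x ∈ K, t • x ∈ K

/-- The order induced by `K`: `coneLE K x y` means `x ≤_K y`, that is, `y - x ∈ K`. -/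
def coneLE [AddCommGroup E₂] (K : Set E₂) (x y : E₂) : Prop :=
  y - x ∈ K

/-- The graph of a map `F : D → E₂`, `D ⊆ E₁`, as a subset of `E₁ × E₂`. -/
def gph {D : Set E₁} (F : D → E₂) : Set (E₁ × E₂) :=
  {p | ∃ h : p.1 ∈ D, F ⟨p.1, h⟩ = p.2}

/-- The `K`-epigraph `{(x, y) ∈ D × E₂ | F x ≤_K y}` of `F : D → E₂`, `D ⊆ E₁`. -/
def coneEpi [AddCommGroup E₂] (K : Set E₂) {D : Set E₁} (F : D → E₂) : Set (E₁ × E₂) :=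
  {p | ∃ h : p.1 ∈ D, coneLE K (F ⟨p.1, h⟩) p.2}

/-- `F` is `K`-convex: its `K`-epigraph is convex. -/
def ConeConvex [AddCommGroup E₁] [Module ℝ E₁] [AddCommGroup E₂] [Module ℝ E₂]
    (K : Set E₂) {D : Set E₁} (F : D → E₂) : Prop :=
  Convex ℝ (coneEpi K F)

/-- `F` is `K`-closed: its `K`-epigraph is closed in `E₁ × E₂`. -/
def ConeClosed [TopologicalSpace E₁] [AddCommGroup E₂] [TopologicalSpace E₂]
    (K : Set E₂) {D : Set E₁} (F : D → E₂) : Prop :=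
  IsClosed (coneEpi K F)

/-- All closed convex cones with respect to which `F` is convex. -/
def convexityCones [AddCommGroup E₁] [Module ℝ E₁]
    [AddCommGroup E₂] [Module ℝ E₂] [TopologicalSpace E₂]
    {D : Set E₁} (F : D → E₂) : Set (Set E₂) :=
  {K | IsCone K ∧ IsClosed K ∧ Convex ℝ K ∧ ConeConvex K F}

/-- All closed convex cones with respect to which `F` is convex and closed. -/
def closedConvexityCones [AddCommGroup E₁] [Module ℝ E₁] [TopologicalSpace E₁]
    [AddCommGroup E₂] [Module ℝ E₂] [TopologicalSpace E₂]
    {D : Set E₁} (F : D → E₂) : Set (Set E₂) :=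
  {K | IsCone K ∧ IsClosed K ∧ Convex ℝ K ∧ ConeConvex K F ∧ ConeClosed K F}

/-- The cone `K_F`, as the intersection of all closed convex cones with respect to which `F` is
convex. It is the smallest such cone as soon as there is a smallest one. -/
def coneK [AddCommGroup E₁] [Module ℝ E₁]
    [AddCommGroup E₂] [Module ℝ E₂] [TopologicalSpace E₂]
    {D : Set E₁} (F : D → E₂) : Set E₂ :=
  ⋂₀ convexityCones F

/-- The cone `K̂_F`, as the intersection of all closed convex cones with respect to which `F` is
convex and closed. It is the smallest such cone as soon as there is a smallest one. -/
def coneKHat [AddCommGroup E₁] [Module ℝ E₁] [TopologicalSpace E₁]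
    [AddCommGroup E₂] [Module ℝ E₂] [TopologicalSpace E₂]
    {D : Set E₁} (F : D → E₂) : Set E₂ :=
  ⋂₀ closedConvexityCones F

end ConeMaps

/-- The space `𝕊ⁿ` of real symmetric `n × n` matrices, with the topology it inherits from the
matrix space (the topology of every norm on it). -/
def SymMat (n : ℕ) : Submodule ℝ (Matrix (Fin n) (Fin n) ℝ) where
  carrier := {A | A.IsSymm}
  add_mem' hA hB := hA.add hB
  zero_mem' := Matrix.isSymm_zero
  smul_mem' c _ hA := hA.smul c

/-- `𝕊ⁿ₊`: the positive semidefinite matrices. -/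
def psdCone (n : ℕ) : Set (SymMat n) :=
  {A | (A : Matrix (Fin n) (Fin n) ℝ).PosSemidef}

/-- `𝕊ⁿ₊₊`: the positive definite matrices. -/
def pdCone (n : ℕ) : Set (SymMat n) :=
  {A | (A : Matrix (Fin n) (Fin n) ℝ).PosDef}

/-- The inverse matrix map `F : 𝕊ⁿ₊₊ → 𝕊ⁿ`, `F X = X⁻¹`. -/
noncomputable def invMap (n : ℕ) : pdCone n → SymMat n :=
  fun X => ⟨((X : SymMat n) : Matrix (Fin n) (Fin n) ℝ)⁻¹, by
    have h : ((X : SymMat n) : Matrix (Fin n) (Fin n) ℝ).IsSymm := (X : SymMat n).2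
    change Matrix.transpose _ = _
    rw [Matrix.transpose_nonsing_inv, h.eq]⟩

open Filter Topology Matrix

/-! By the Schur complement, `(X, Y)` lies in the epigraph iff the block matrix `[[X, 1], [1, Y]]`
is positive semidefinite. This is a family of affine inequalities in `(X, Y)`, so convexity and
closedness come together. Minimality: on the ray `t • Q⁻¹` the map takes the values `t⁻¹ • Q`, and
its midpoint convexity gap is a positive multiple of `Q`. An admissible cone thus contains every
positive definite `Q`, hence the closure. Hull: the graph point `(t • Q⁻¹, t⁻¹ • Q)` with weight `t`
contributes `(t ^ 2 • Q⁻¹, Q)`, which tends to `(0, Q)`. So the closed hull absorbs the semidefinite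
directions that build the epigraph from the graph. -/

/-- For a positive definite matrix `A`, a symmetric `B` dominates `A⁻¹` exactly when the block
quadratic form with blocks `A, 1, 1, B` is nonnegative. -/
theorem Matrix.PosDef.posSemidef_sub_inv_iff {n : ℕ} {A B : Matrix (Fin n) (Fin n) ℝ}
    (hA : A.PosDef) (hB : B.IsSymm) :
    (B - A⁻¹).PosSemidef ↔
      ∀ u v : Fin n → ℝ, 0 ≤ u ⬝ᵥ A *ᵥ u + 2 * (u ⬝ᵥ v) + v ⬝ᵥ B *ᵥ v := by
  have hAs : Aᵀ = A := hA.isHermitian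
  have hdet : IsUnit A.det := (Matrix.isUnit_iff_isUnit_det A).1 hA.isUnit
  have hAA (v : Fin n → ℝ) : A *ᵥ (A⁻¹ *ᵥ v) = v := by
    rw [Matrix.mulVec_mulVec, Matrix.mul_nonsing_inv A hdet, Matrix.one_mulVec]
  have hsymm (u v : Fin n → ℝ) : u ⬝ᵥ A *ᵥ v = v ⬝ᵥ A *ᵥ u := by
    rw [Matrix.dotProduct_mulVec, ← Matrix.mulVec_transpose, hAs, dotProduct_comm]
  -- Complete the square in `u`; the first term vanishes at `u = -A⁻¹ v`.
  have hsquare (u v : Fin n → ℝ) : u ⬝ᵥ A *ᵥ u + 2 * (u ⬝ᵥ v) + v ⬝ᵥ B *ᵥ v =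
      (u + A⁻¹ *ᵥ v) ⬝ᵥ A *ᵥ (u + A⁻¹ *ᵥ v) + v ⬝ᵥ (B - A⁻¹) *ᵥ v := by
    simp only [Matrix.mulVec_add, Matrix.sub_mulVec, add_dotProduct, dotProduct_add,
      dotProduct_sub, hAA, hsymm (A⁻¹ *ᵥ v) u, dotProduct_comm (A⁻¹ *ᵥ v) v]
    ring
  constructor
  · intro h u v
    rw [hsquare]
    exact add_nonneg (by simpa using hA.posSemidef.dotProduct_mulVec_nonneg (u + A⁻¹ *ᵥ v))
      (by simpa using h.dotProduct_mulVec_nonneg v)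
  · intro h
    refine .of_dotProduct_mulVec_nonneg (IsHermitian.sub hB hA.isHermitian.inv) fun v => ?_
    have := h (-(A⁻¹ *ᵥ v)) v
    rw [hsquare] at this
    simpa using this

/-- If the block quadratic form with blocks `A, 1, 1, B` is nonnegative, then `A` is positive
definite. -/
theorem Matrix.IsSymm.posDef_of_block_nonneg {n : ℕ} {A B : Matrix (Fin n) (Fin n) ℝ}
    (hA : A.IsSymm)
    (h : ∀ u v : Fin n → ℝ, 0 ≤ u ⬝ᵥ A *ᵥ u + 2 * (u ⬝ᵥ v) + v ⬝ᵥ B *ᵥ v) : A.PosDef := by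
  refine .of_dotProduct_mulVec_pos hA fun x hx => ?_
  by_contra! hneg
  rw [star_trivial] at hneg
  have hb : 0 < x ⬝ᵥ x := by simpa using Matrix.dotProduct_star_self_pos_iff.2 hx
  set b := x ⬝ᵥ x
  set c := x ⬝ᵥ B *ᵥ x with hc
  -- Along `v = -t • x` the cross term is linear in `t` and beats the quadratic one for small `t >
  -- 0`.
  have hquad (t : ℝ) : 0 ≤ -(2 * t * b) + t ^ 2 * c := by
    have := h x (-t • x)
    simp only [Matrix.mulVec_smul, smul_dotProduct, dotProduct_smul, smul_eq_mul] at this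
    linarith
  have hpos : 0 < |c| + 1 := by positivity
  have h1 := hquad (b / (|c| + 1))
  have h2 : -(2 * (b / (|c| + 1)) * b) + (b / (|c| + 1)) ^ 2 * c =
      (b / (|c| + 1)) ^ 2 * (c - 2 * (|c| + 1)) := by
    field_simp
    ring
  rw [h2] at h1
  have h3 : 0 < (b / (|c| + 1)) ^ 2 := by positivity
  have h4 := nonneg_of_mul_nonneg_right h1 h3
  linarith [le_abs_self c, abs_nonneg c]

/-- The inequalities already force `p.1` to be positive definite, so the open domain condition
disappears; this is what makes the epigraph closed. -/
theorem mem_coneEpi_invMap_iff {n : ℕ} (p : SymMat n × SymMat n) :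
    p ∈ coneEpi (psdCone n) (invMap n) ↔
      ∀ u v : Fin n → ℝ, 0 ≤ u ⬝ᵥ p.1.1 *ᵥ u + 2 * (u ⬝ᵥ v) + v ⬝ᵥ p.2.1 *ᵥ v := by
  constructor
  · rintro ⟨h1, h2⟩
    exact (Matrix.PosDef.posSemidef_sub_inv_iff h1 p.2.2).1 h2
  · intro h
    have h1 : p.1.1.PosDef := Matrix.IsSymm.posDef_of_block_nonneg p.1.2 h
    exact ⟨h1, (h1.posSemidef_sub_inv_iff p.2.2).2 h⟩

theorem coneConvex_invMap (n : ℕ) : ConeConvex (psdCone n) (invMap n) := by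
  intro p hp q hq a b ha hb hab
  rw [mem_coneEpi_invMap_iff] at hp hq ⊢
  intro u v
  have h := add_nonneg (mul_nonneg ha (hp u v)) (mul_nonneg hb (hq u v))
  simp only [Prod.fst_add, Prod.snd_add, Prod.smul_fst, Prod.smul_snd, Submodule.coe_add,
    Submodule.coe_smul, Matrix.add_mulVec, Matrix.smul_mulVec, dotProduct_add, dotProduct_smul,
    smul_eq_mul]
  have hb' : b = 1 - a := by linarith
  subst hb'
  linarith

theorem coneClosed_invMap (n : ℕ) : ConeClosed (psdCone n) (invMap n) := by
  have h : coneEpi (psdCone n) (invMap n) = ⋂ (u : Fin n → ℝ) (v : Fin n → ℝ),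
      {p : SymMat n × SymMat n |
        0 ≤ u ⬝ᵥ p.1.1 *ᵥ u + 2 * (u ⬝ᵥ v) + v ⬝ᵥ p.2.1 *ᵥ v} := by
    ext p
    simp only [mem_coneEpi_invMap_iff, Set.mem_iInter, Set.mem_ofPred_eq]
  rw [ConeClosed, h]
  exact isClosed_iInter fun u => isClosed_iInter fun v =>
    isClosed_le continuous_const (by fun_prop)

theorem isCone_psdCone (n : ℕ) : IsCone (psdCone n) :=
  ⟨⟨0, Matrix.PosSemidef.zero⟩, fun _ ht _ hX => Matrix.PosSemidef.smul hX ht⟩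

theorem convex_psdCone (n : ℕ) : Convex ℝ (psdCone n) := fun _ hX _ hY _ _ ha hb _ =>
  (Matrix.PosSemidef.smul hX ha).add (Matrix.PosSemidef.smul hY hb)

theorem isClosed_psdCone (n : ℕ) : IsClosed (psdCone n) := by
  have h : psdCone n = ⋂ u : Fin n → ℝ, {X : SymMat n | 0 ≤ u ⬝ᵥ X.1 *ᵥ u} := by
    ext X
    simp only [Set.mem_iInter, Set.mem_ofPred_eq]
    exact ⟨fun hX u => by simpa using Matrix.PosSemidef.dotProduct_mulVec_nonneg hX u,
      fun hX => .of_dotProduct_mulVec_nonneg X.2 fun u => by simpa using hX u⟩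
  rw [h]
  exact isClosed_iInter fun u => isClosed_le continuous_const (by fun_prop)

/-- Every positive semidefinite matrix is a limit of positive definite ones. -/
theorem psdCone_subset_closure_pdCone (n : ℕ) : psdCone n ⊆ closure (pdCone n) := by
  intro P hP
  let I : SymMat n := ⟨1, Matrix.isSymm_one⟩
  have hlim : Tendsto (fun t : ℝ => P + t • I) (𝓝[>] 0) (𝓝 P) := by
    have hc : Continuous fun t : ℝ => P + t • I := by fun_prop
    simpa using (hc.tendsto 0).mono_left nhdsWithin_le_nhds
  refine mem_closure_of_tendsto hlim ?_
  filter_upwards [self_mem_nhdsWithin] with t ht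
  exact Matrix.PosDef.posSemidef_add hP (Matrix.PosDef.one.smul ht)

theorem invMap_smul_inv_mem_gph {n : ℕ} {Q : SymMat n} (hQ : Q ∈ pdCone n) {t : ℝ} (ht : 0 < t) :
    (t • invMap n ⟨Q, hQ⟩, t⁻¹ • Q) ∈ gph (invMap n) := by
  have hQ' : Q.1.PosDef := hQ
  have hdet : IsUnit Q.1.det := (Matrix.isUnit_iff_isUnit_det _).1 hQ'.isUnit
  refine ⟨hQ'.inv.smul ht, Subtype.ext ?_⟩
  change (t • Q.1⁻¹)⁻¹ = t⁻¹ • Q.1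
  refine Matrix.inv_eq_right_inv ?_
  rw [Matrix.smul_mul, Matrix.mul_smul, smul_smul, mul_inv_cancel₀ ht.ne',
    Matrix.nonsing_inv_mul _ hdet, one_smul]

/-- The epigraph with respect to a set containing `0` contains the graph. -/
theorem gph_subset_coneEpi {E₁ E₂ : Type*} [AddCommGroup E₂] {K : Set E₂} (hK : (0 : E₂) ∈ K)
    {D : Set E₁} (F : D → E₂) : gph F ⊆ coneEpi K F := by
  rintro p ⟨h, hp⟩
  exact ⟨h, by rwa [coneLE, hp, sub_self]⟩

theorem IsCone.zero_mem {E : Type*} [AddCommGroup E] [Module ℝ E] {K : Set E} (hK : IsCone K) :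
    (0 : E) ∈ K := by
  obtain ⟨x, hx⟩ := hK.1
  simpa using hK.2 0 le_rfl x hx

/-- The positive semidefinite cone lies in every closed convexity cone of matrix inversion: test
convexity on the points `Q⁻¹` and `3 • Q⁻¹`. -/
theorem psdCone_subset_of_mem_convexityCones {n : ℕ} {K : Set (SymMat n)}
    (hK : K ∈ convexityCones (invMap n)) : psdCone n ⊆ K := by
  obtain ⟨hcone, hclosed, -, hF⟩ := hK
  refine (psdCone_subset_closure_pdCone n).trans (closure_minimal (fun Q hQ => ?_) hclosed)
  have hmem {t : ℝ} (ht : 0 < t) := invMap_smul_inv_mem_gph hQ ht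
  have hmid := hF (gph_subset_coneEpi hcone.zero_mem _ (hmem one_pos))
    (gph_subset_coneEpi hcone.zero_mem _ (hmem three_pos))
    (by norm_num : (0 : ℝ) ≤ 1 / 2) (by norm_num : (0 : ℝ) ≤ 1 / 2) (by norm_num)
  obtain ⟨h2, hval⟩ := hmem two_pos
  have hpt : (1 / 2 : ℝ) • ((1 : ℝ) • invMap n ⟨Q, hQ⟩, (1 : ℝ)⁻¹ • Q) +
      (1 / 2 : ℝ) • ((3 : ℝ) • invMap n ⟨Q, hQ⟩, (3 : ℝ)⁻¹ • Q) =
      ((2 : ℝ) • invMap n ⟨Q, hQ⟩, (2 / 3 : ℝ) • Q) := by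
    ext1
    · simp only [Prod.fst_add, Prod.smul_fst]
      module
    · simp only [Prod.snd_add, Prod.smul_snd]
      module
  rw [hpt] at hmid
  obtain ⟨_, hle⟩ := hmid
  dsimp only at hval hle
  rw [coneLE, hval] at hle
  -- The gap at the midpoint is `2/3 - 1/2 = 1/6` times `Q`.
  have := hcone.2 6 (by norm_num) _ hle
  convert this using 1
  module

/-- Positive semidefinite matrices are recession directions, in the second factor, of the closed
convex hull of the graph of matrix inversion. -/
theorem add_mem_closedConvexHull_gph_invMap {n : ℕ} {p : SymMat n × SymMat n}
    (hp : p ∈ closedConvexHull ℝ (gph (invMap n))) {P : SymMat n} (hP : P ∈ psdCone n) :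
    p + (0, P) ∈ closedConvexHull ℝ (gph (invMap n)) := by
  have hcl : IsClosed {P : SymMat n | p + (0, P) ∈ closedConvexHull ℝ (gph (invMap n))} :=
    isClosed_closedConvexHull.preimage (by fun_prop)
  refine closure_minimal (fun Q hQ => ?_) hcl (psdCone_subset_closure_pdCone n hP)
  -- The curve is the convex combination of `p` and `(t • Q⁻¹, t⁻¹ • Q)` with weights `1 - t` and
  -- `t`.
  have hlim : Tendsto (fun t : ℝ => (1 - t) • p + (t ^ 2 • invMap n ⟨Q, hQ⟩, Q)) (𝓝[>] 0)
      (𝓝 (p + (0, Q))) := by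
    have hc : Continuous fun t : ℝ => (1 - t) • p + (t ^ 2 • invMap n ⟨Q, hQ⟩, Q) := by fun_prop
    simpa using (hc.tendsto 0).mono_left nhdsWithin_le_nhds
  refine isClosed_closedConvexHull.mem_of_tendsto hlim ?_
  filter_upwards [Ioo_mem_nhdsGT (zero_lt_one' ℝ)] with t ht
  have h := convex_closedConvexHull hp
    (subset_closedConvexHull (𝕜 := ℝ) (invMap_smul_inv_mem_gph hQ ht.1))
    (sub_nonneg.2 ht.2.le) ht.1.le (by ring)
  rwa [Prod.smul_mk t, smul_smul, smul_smul, mul_inv_cancel₀ ht.1.ne', one_smul, ← sq] at h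

theorem closedConvexHull_gph_invMap (n : ℕ) :
    closedConvexHull ℝ (gph (invMap n)) = coneEpi (psdCone n) (invMap n) := by
  refine (closedConvexHull_min (gph_subset_coneEpi (isCone_psdCone n).zero_mem _)
    (coneConvex_invMap n) (coneClosed_invMap n)).antisymm ?_
  rintro ⟨X, Y⟩ ⟨hX, hY⟩
  -- Split `(X, Y) = (X, X⁻¹) + (0, Y - X⁻¹)`.
  have h := add_mem_closedConvexHull_gph_invMap
    (subset_closedConvexHull (𝕜 := ℝ) (show (X, invMap n ⟨X, hX⟩) ∈ gph (invMap n) from ⟨hX, rfl⟩))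
    hY
  simpa using h

theorem isLeast_convexityCones_invMap (n : ℕ) :
    IsLeast (convexityCones (invMap n)) (psdCone n) :=
  ⟨⟨isCone_psdCone n, isClosed_psdCone n, convex_psdCone n, coneConvex_invMap n⟩,
    fun _ hK => psdCone_subset_of_mem_convexityCones hK⟩

theorem isLeast_closedConvexityCones_invMap (n : ℕ) :
    IsLeast (closedConvexityCones (invMap n)) (psdCone n) :=
  ⟨⟨isCone_psdCone n, isClosed_psdCone n, convex_psdCone n, coneConvex_invMap n,
    coneClosed_invMap n⟩,
    fun _ hK => psdCone_subset_of_mem_convexityCones ⟨hK.1, hK.2.1, hK.2.2.1, hK.2.2.2.1⟩⟩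

theorem mainTheorem11 (n : ℕ) :
    -- `K_F` and `K̂_F` exist as smallest cones, and both are `𝕊ⁿ₊`
    (IsLeast (convexityCones (invMap n)) (coneK (invMap n)) ∧
      IsLeast (closedConvexityCones (invMap n)) (coneKHat (invMap n)) ∧
      coneKHat (invMap n) = coneK (invMap n) ∧
      coneK (invMap n) = psdCone n) ∧
    -- `F` is `𝕊ⁿ₊`-convex and `𝕊ⁿ₊`-closed
    (ConeConvex (psdCone n) (invMap n) ∧ ConeClosed (psdCone n) (invMap n)) ∧
    -- the closed convex hull of the graph is the `𝕊ⁿ₊`-epigraph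
    closedConvexHull ℝ (gph (invMap n)) = coneEpi (psdCone n) (invMap n) := by
  have hK : coneK (invMap n) = psdCone n := (isLeast_convexityCones_invMap n).isGLB.sInf_eq
  have hKHat : coneKHat (invMap n) = psdCone n :=
    (isLeast_closedConvexityCones_invMap n).isGLB.sInf_eq
  rw [hK, hKHat]
  exact ⟨⟨isLeast_convexityCones_invMap n, isLeast_closedConvexityCones_invMap n, rfl, rfl⟩,
    ⟨coneConvex_invMap n, coneClosed_invMap n⟩, closedConvexHull_gph_invMap n⟩
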